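/- Let $k$ be a field, let $G$ be a finite group whose order is invertible in $k$, and let $G$ act from the left by (unit preserving) $k$-algebra automorphisms on an associative unital $k$-algebra $A$ (not assumed finite dimensional). Let $A\rtimes G=\bigoplus_{g\in G}Ag$ be the crossed product algebra, with multiplication $(a_1g_1)(a_2g_2)=(a_1\,g_1(a_2))(g_1g_2)$; each summand $Ag$ is an $A$-$A$-bimodule with $a\,(xg)\,b=(a\,x\,g(b))\,g$. For a $k$-algebra $B$ and a $B$-$B$-bimodule $M$ (with equal left and right actions of $k$) write $HH^n(B,M)=\operatorname{Ext}^n_{B\otimes_k B^{\mathrm{op}}}(B,M)$. The group $G$ acts on $\bigoplus_{g\in G}HH^\bullet(A,Ag)$ by conjugation: $s\in G$ maps $HH^n(A,Ag)$ to $HH^n(A,A(sgs^{-1}))$ by transport of structure along $s\colon A\to A$ and $Ag\to A(sgs^{-1})$, $xg\mapsto s(x)\,sgs^{-1}$. The graded space $\bigoplus_{g\in G}HH^\bullet(A,Ag)$ is a graded $k$-algebra: the product of $\xi\in HH^p(A,Ag)$ and $\zeta\in HH^q(A,Ah)$ is their horizontal composite, the composite $A\xrightarrow{\ \xi\ }Ag\cong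 Ag\otimes_A A\xrightarrow{\ Ag\otimes_A\zeta\ }Ag\otimes_A Ah\cong A(gh)$ in $HH^{p+q}(A,A(gh))$, and the unit is the isomorphism $A\cong A1$ in $HH^0(A,A1)$. Then there is an isomorphism of graded $k$-algebras $$HH^\bullet(A\rtimes G,A\rtimes G)\;\cong\;\Bigl(\bigoplus_{g\in G}HH^\bullet(A,Ag)\Bigr)^G,$$ that is, there are $k$-linear isomorphisms in every degree $n\ge 0$ that preserve units and products, where the product on the left-hand side is the Yoneda product. -/

import Mathlib

open CategoryTheory MulOpposite
open scoped TensorProduct DirectSum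

universe u v

noncomputable section

namespace CrossedHochschild

section Bimodules

variable (k : Type u) [Field k] (A : Type v) [Ring A] [Algebra k A]

/-- The enveloping algebra `A ⊗ Aᵒᵖ` over `k`. -/
abbrev Env : Type v := A ⊗[k] Aᵐᵒᵖ

/-- The category of `A`-`A`-bimodules with equal left and right actions of `k`, as left modules over
the enveloping algebra: `a ⊗ op b` acts on `m` as `a m b`. -/
abbrev Bimod : Type (v + 1) := ModuleCat.{v} (Env k A)

/-- The regular bimodule `A`. -/
def regular : Bimod k A :=
  letI : Module (Env k A) A := TensorProduct.Algebra.module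
  ModuleCat.of (Env k A) A

/-- An element of `A`, seen in the regular bimodule. -/
def toRegular : A ≃+ regular k A := AddEquiv.refl A

theorem toRegular_smul (a b x : A) :
    (a ⊗ₜ[k] op b) • toRegular k A x = toRegular k A (a * x * b) := by
  let : Module (Env k A) A := TensorProduct.Algebra.module
  change (a ⊗ₜ[k] op b) • x = a * x * b
  rw [TensorProduct.Algebra.smul_def]
  simp [mul_assoc]

/-- Hochschild cohomology of `A` with coefficients in a bimodule `M`, `Ext^n` from `A` to `M`
over `A ⊗ Aᵒᵖ`. -/
abbrev HH (M : Bimod k A) (n : ℕ) : Type v := Abelian.Ext.{v} (regular k A) M n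

variable {k A}

/-- The algebra endomorphism `σ ⊗ τᵒᵖ` of the enveloping algebra. -/
def envMap (σ τ : A →ₐ[k] A) : Env k A →ₐ[k] Env k A :=
  Algebra.TensorProduct.map σ (AlgHom.op τ)

theorem envMap_tmul (σ τ : A →ₐ[k] A) (a b : A) :
    envMap σ τ (a ⊗ₜ[k] op b) = σ a ⊗ₜ[k] op (τ b) := rfl

/-- Twisting of bimodules: `(twist σ τ).obj M` is `M` with `a` acting on the left as `σ a` and `b`
acting on the right as `τ b`. -/
abbrev twist (σ τ : A →ₐ[k] A) : Bimod k A ⥤ Bimod k A :=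
  ModuleCat.restrictScalars (envMap σ τ).toRingHom

/-- An element of `M`, seen in a twist of `M`. -/
def toTwist (σ τ : A →ₐ[k] A) (M : Bimod k A) : M ≃+ (twist σ τ).obj M := AddEquiv.refl M

theorem toTwist_smul (σ τ : A →ₐ[k] A) (M : Bimod k A) (a b : A) (m : M) :
    (a ⊗ₜ[k] op b) • toTwist σ τ M m = toTwist σ τ M ((σ a ⊗ₜ[k] op (τ b)) • m) := rfl

instance twist_preservesFiniteLimits (σ τ : A →ₐ[k] A) :
    Limits.PreservesFiniteLimits (twist σ τ) where
  preservesFiniteLimits _ _ _ := ⟨inferInstance⟩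

instance twist_preservesFiniteColimits (σ τ : A →ₐ[k] A) :
    Limits.PreservesFiniteColimits (twist σ τ) where
  preservesFiniteColimits _ _ _ := ⟨inferInstance⟩

instance twist_linear (σ τ : A →ₐ[k] A) : (twist σ τ).Linear k where
  map_smul {M N} f r := by
    ext m
    change algebraMap k (Env k A) r • f.hom m =
      envMap σ τ (algebraMap k (Env k A) r) • f.hom m
    rw [AlgHom.commutes]

/-- An additive map that is compatible with both actions is a morphism of bimodules. -/
def homMk {M N : Bimod k A} (f : M →+ N)
    (hf : ∀ (a b : A) (m : M), f ((a ⊗ₜ[k] op b) • m) = (a ⊗ₜ[k] op b) • f m) : M ⟶ N :=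
  ModuleCat.ofHom
    { f with
      map_smul' := fun r m => by
        change f (r • m) = r • f m
        induction r using TensorProduct.induction_on with
        | zero =>
          exact (congrArg f (zero_smul (Env k A) m)).trans
            ((map_zero f).trans (zero_smul (Env k A) (f m)).symm)
        | tmul a b => exact hf a b.unop m
        | add x y hx hy => rw [add_smul, add_smul, map_add, hx, hy] }

end Bimodules

section Equivariant

variable (k : Type u) [Field k] (A : Type v) [Ring A] [Algebra k A]
  {G : Type v} [Group G] [MulSemiringAction G A] [SMulCommClass G k A]

/-- `g`, as an algebra endomorphism of `A`. -/
abbrev act (g : G) : A →ₐ[k] A := MulSemiringAction.toAlgHom k A g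

/-- The bimodule `Ag`, the summand of the crossed product at `g`: it is `A`, where the element `x`
stands for `x g`, with `a (x g) b = (a x g(b)) g`. -/
def Ag (g : G) : Bimod k A := (twist (AlgHom.id k A) (act k A g)).obj (regular k A)

/-- The element `x g` of `Ag`. -/
def toAg (g : G) : A ≃+ Ag k A g :=
  (toRegular k A).trans (toTwist (AlgHom.id k A) (act k A g) (regular k A))

variable {k A}

theorem toAg_smul (g : G) (a b x : A) :
    (a ⊗ₜ[k] op b) • toAg k A g x = toAg k A g (a * x * g • b) := by
  change (a ⊗ₜ[k] op b) • toTwist _ _ _ (toRegular k A x) = toTwist _ _ _ (toRegular k A _)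
  rw [toTwist_smul, toRegular_smul]
  rfl

/-! The action of `s` on the cohomology: `HH(A, Ag) → HH(A, A(s g s⁻¹))`. -/

variable (k A) in
/-- Transport of structure along `s`: the bimodule with underlying group that of `M`, on which
`a`, `b` act as `s⁻¹(a)`, `s⁻¹(b)`. -/
abbrev conjTwist (s : G) : Bimod k A ⥤ Bimod k A := twist (act k A s⁻¹) (act k A s⁻¹)

variable (k A) in
/-- The isomorphism from `A` to its transport along `s`, `x ↦ s⁻¹(x)`. -/
def conjSource (s : G) : regular k A ⟶ (conjTwist k A s).obj (regular k A) :=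
  homMk
    (((toRegular k A).symm.trans (MulSemiringAction.toRingEquiv G A s⁻¹).toAddEquiv).trans
      ((toRegular k A).trans (toTwist _ _ _))).toAddMonoidHom
    (fun a b m => by
      obtain ⟨x, rfl⟩ := (toRegular k A).surjective m
      rw [toRegular_smul]
      change toTwist _ _ _ (toRegular k A (s⁻¹ • (a * x * b))) =
        _ • toTwist _ _ _ (toRegular k A (s⁻¹ • x))
      rw [toTwist_smul, toRegular_smul]
      simp [smul_mul'])

variable (k A) in
/-- The isomorphism to `A(s g s⁻¹)` from the transport of `Ag` along `s`,
`x g ↦ s(x) (s g s⁻¹)`. -/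
def conjTarget (s g : G) : (conjTwist k A s).obj (Ag k A g) ⟶ Ag k A (s * g * s⁻¹) :=
  homMk
    (((toTwist _ _ _).symm.trans (toAg k A g).symm).trans
      ((MulSemiringAction.toRingEquiv G A s).toAddEquiv.trans
        (toAg k A (s * g * s⁻¹)))).toAddMonoidHom
    (fun a b m => by
      obtain ⟨m, rfl⟩ := (toTwist _ _ _).surjective m
      obtain ⟨x, rfl⟩ := (toAg k A g).surjective m
      rw [toTwist_smul, toAg_smul]
      change toAg k A _ (s • _) = _ • toAg k A _ (s • x)
      rw [toAg_smul]
      simp [smul_mul', mul_smul])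

variable (k A) in
/-- The action of `s` as a map `HH^n(A, Ag) → HH^n(A, A(s g s⁻¹))`: transport of structure
along `s`, composed with the identifications `conjSource` and `conjTarget`. -/
def conjHH (s g : G) (n : ℕ) :
    HH k A (Ag k A g) n →ₗ[k] HH k A (Ag k A (s * g * s⁻¹)) n where
  toFun x := (Abelian.Ext.mk₀ (conjSource k A s)).comp
    ((x.mapExactFunctor (conjTwist k A s)).comp
      (Abelian.Ext.mk₀ (conjTarget k A s g)) (add_zero n)) (zero_add n)
  map_add' x y := by simp
  map_smul' r x := by simp

/-! The product `HH(A, Ag) × HH(A, Ah) → HH(A, Agh)`. -/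

variable (k A) in
/-- The functor `Ag ⊗_A -`: the bimodule `Ag ⊗_A M` is `M`, where `m` stands for `g ⊗ m`,
with `a (g ⊗ m) b = g ⊗ g⁻¹(a) m b`. -/
abbrev tensorAg (g : G) : Bimod k A ⥤ Bimod k A := twist (act k A g⁻¹) (AlgHom.id k A)

variable (k A) in
/-- The isomorphism from `Ag` to `Ag ⊗_A A`, `x g ↦ x g ⊗ 1 = g ⊗ g⁻¹(x)`. -/
def rightUnitor (g : G) : Ag k A g ⟶ (tensorAg k A g).obj (regular k A) :=
  homMk
    (((toAg k A g).symm.trans (MulSemiringAction.toRingEquiv G A g⁻¹).toAddEquiv).trans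
      ((toRegular k A).trans (toTwist _ _ _))).toAddMonoidHom
    (fun a b m => by
      obtain ⟨x, rfl⟩ := (toAg k A g).surjective m
      rw [toAg_smul]
      change toTwist _ _ _ (toRegular k A (g⁻¹ • (a * x * g • b))) =
        _ • toTwist _ _ _ (toRegular k A (g⁻¹ • x))
      rw [toTwist_smul, toRegular_smul]
      simp [smul_mul'])

variable (k A) in
/-- The isomorphism from `Ag ⊗_A Ah` to `A(gh)`, `g ⊗ x h ↦ g(x) gh`. -/
def mulAg (g h : G) : (tensorAg k A g).obj (Ag k A h) ⟶ Ag k A (g * h) :=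
  homMk
    (((toTwist _ _ _).symm.trans (toAg k A h).symm).trans
      ((MulSemiringAction.toRingEquiv G A g).toAddEquiv.trans
        (toAg k A (g * h)))).toAddMonoidHom
    (fun a b m => by
      obtain ⟨m, rfl⟩ := (toTwist _ _ _).surjective m
      obtain ⟨x, rfl⟩ := (toAg k A h).surjective m
      rw [toTwist_smul, toAg_smul]
      change toAg k A _ (g • _) = _ • toAg k A _ (g • x)
      rw [toAg_smul]
      simp [smul_mul', mul_smul])

/-- The product of `x : A → Ag` of degree `p` and `y : A → Ah` of degree `q` in the derived
category, the horizontal composite `A → Ag ≅ Ag ⊗_A A → Ag ⊗_A Ah ≅ A(gh)` of degree `p + q`. -/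
def mulHH {g h : G} {p q : ℕ} (x : HH k A (Ag k A g) p) (y : HH k A (Ag k A h) q) :
    HH k A (Ag k A (g * h)) (p + q) :=
  x.comp ((Abelian.Ext.mk₀ (rightUnitor k A g)).comp
    ((y.mapExactFunctor (tensorAg k A g)).comp
      (Abelian.Ext.mk₀ (mulAg k A g h)) (add_zero q)) (zero_add q)) rfl

variable (k A) in
/-- The isomorphism from `A` to the summand of the crossed product at `1`, `x ↦ x 1`. -/
def oneAg : regular k A ⟶ Ag k A (1 : G) :=
  homMk ((toRegular k A).symm.trans (toAg k A (1 : G))).toAddMonoidHom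
    (fun a b m => by
      obtain ⟨x, rfl⟩ := (toRegular k A).surjective m
      rw [toRegular_smul]
      change toAg k A (1 : G) (a * x * b) = _ • toAg k A (1 : G) x
      rw [toAg_smul, one_smul])

open scoped Classical in
variable (k A G) in
/-- The degree `n` part of `⨁ g, HH(A, Ag)`. -/
abbrev TwistedHH (n : ℕ) : Type v := ⨁ g : G, HH k A (Ag k A g) n

open scoped Classical in
variable (k A) in
/-- The action of `s` on `⨁ g, HH^n(A, Ag)`; it maps the summand at `g` to that at `s g s⁻¹`. -/
def conjTwistedHH (n : ℕ) (s : G) : TwistedHH k A G n →ₗ[k] TwistedHH k A G n :=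
  DirectSum.toModule k G _ fun g =>
    (DirectSum.lof k G (fun g => HH k A (Ag k A g) n) (s * g * s⁻¹)).comp (conjHH k A s g n)

variable (k A G) in
/-- The `G`-invariants of `⨁ g, HH^n(A, Ag)`. -/
def invariants (n : ℕ) : Submodule k (TwistedHH k A G n) where
  carrier := {x | ∀ s : G, conjTwistedHH k A n s x = x}
  add_mem' hx hy s := by rw [map_add, hx s, hy s]
  zero_mem' s := map_zero _
  smul_mem' r x hx s := by rw [map_smul, hx s]

open scoped Classical in
/-- The unit of `⨁ g, HH(A, Ag)`. -/
def oneTwistedHH : TwistedHH k A G 0 :=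
  DirectSum.of (fun g => HH k A (Ag k A g) 0) (1 : G) (Abelian.Ext.mk₀ (oneAg k A))

open scoped Classical in
/-- The product of `⨁ g, HH(A, Ag)`; the product of the summands at `g` and `h` lies in that
at `g h`. -/
def mulTwistedHH [Fintype G] {p q : ℕ} (x : TwistedHH k A G p) (y : TwistedHH k A G q) :
    TwistedHH k A G (p + q) :=
  ∑ g : G, ∑ h : G,
    DirectSum.of (fun g => HH k A (Ag k A g) (p + q)) (g * h) (mulHH (x g) (y h))

end Equivariant

end CrossedHochschild

end

/-!
Write `B = A ⋊ G`, and let `res` denote the exact restriction of bimodules from `B` to `A`. The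
isomorphism sends a class `y : B → B` of degree `n` to the restricted class `A → B → B`, the
composite of the inclusion `unitRes` of `A` with `res y`, decomposed along `B = ⨁ g, Ag`
(`resHH` and `totalHH`).

All compatibilities come from natural transformations of exact functors, along which the induced
maps on `Ext` are natural (`mapExactFunctor_naturality`). On bimodules `N` over `B` there are left
multiplication `Ag ⊗_A N → N` (`leftMul`) and conjugation by `s` (`conjRes`). Naturality of the
first turns the Yoneda product into the horizontal product (`totalHH_mulTwistedHH`), naturality of
the second shows that restricted classes are invariant (`conjResHH_resHH`).

For bijectivity, `B` acts on itself as a free right `A`-module with basis `G`, which represents it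
by matrices over `A` (`matrixRep`). Hence matrices with entries in an `A`-bimodule form a bimodule
over `B`, and this defines an exact functor `matrices` from `A`-bimodules to `B`-bimodules. There
are maps `matrices (res N) → N`, `f ↦ ∑ x y, x f(x, y) y⁻¹` (`collapse`) and `B → matrices A`
(`toMatricesRegular`). Together they turn a class `A → res N` into a class
`B → matrices A → matrices (res N) → N`, the transfer (`transferHH`). Transfer after restriction is
multiplication by `|G|` because `B → matrices A → matrices (res B) → B` is
(`toMatricesRegular_comp_collapse`). Restriction after transfer is the sum over the conjugates by
elements of `G` because the matrix that represents `a ∈ A` is diagonal with entries `x⁻¹(a)`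
(`unitRes_comp_toMatricesRegular`); on invariants it is again multiplication by `|G|`. As `|G|` is
invertible, restriction is bijective onto the invariants.
-/

/-! ### Naturality of the maps on `Ext` induced by exact functors -/

namespace CategoryTheory.Abelian.Ext

open Limits

universe w w' w'' u₁ v₁ u₂ v₂ u₃ v₃

variable {C : Type u₁} [Category.{v₁} C] [Abelian C] {D : Type u₂} [Category.{v₂} D] [Abelian D]
  {E : Type u₃} [Category.{v₃} E] [Abelian E] [HasExt.{w} C] [HasExt.{w'} D] [HasExt.{w''} E]

/-- Classes of positive degree are Yoneda products of classes of smaller degree with classes of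
short exact sequences; this allows induction on the degree. -/
theorem exists_eq_comp_extClass [EnoughInjectives C] {X Y : C} {n : ℕ} (x : Ext.{w} X Y (n + 1)) :
    ∃ (I Q : C) (i : Y ⟶ I) (p : I ⟶ Q) (w : i ≫ p = 0)
      (hS : (ShortComplex.mk i p w).ShortExact) (y : Ext.{w} X Q n),
      y.comp hS.extClass rfl = x := by
  have hS : (ShortComplex.mk (Injective.ι Y) (cokernel.π (Injective.ι Y)) (by simp)).ShortExact :=
    { exact := ShortComplex.exact_of_g_is_cokernel _ (cokernelIsCokernel _) }
  obtain ⟨y, hy⟩ := covariant_sequence_exact₁ X hS x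
    (eq_zero_of_injective (I := Injective.under Y) _) rfl
  exact ⟨_, _, _, _, _, hS, y, hy⟩

/-- The maps on `Ext` induced by exact functors are natural in the functor. -/
theorem mapExactFunctor_naturality [EnoughInjectives C] (F F' : C ⥤ D)
    [F.Additive] [PreservesFiniteLimits F] [PreservesFiniteColimits F]
    [F'.Additive] [PreservesFiniteLimits F'] [PreservesFiniteColimits F']
    (α : F ⟶ F') {X Y : C} {n : ℕ} (x : Ext.{w} X Y n) :
    (x.mapExactFunctor F).comp (mk₀ (α.app Y)) (add_zero n) =
      (mk₀ (α.app X)).comp (x.mapExactFunctor F') (zero_add n) := by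
  induction n generalizing Y with
  | zero =>
    obtain ⟨f, rfl⟩ := (mk₀_bijective X Y).2 x
    simp [mapExactFunctor_mk₀]
  | succ n ih =>
    obtain ⟨I, Q, i, p, w, hS, y, rfl⟩ := exists_eq_comp_extClass x
    have key : (hS.extClass.mapExactFunctor F).comp (mk₀ (α.app Y)) (add_zero 1) =
        (mk₀ (α.app Q)).comp (hS.extClass.mapExactFunctor F') (zero_add 1) := by
      rw [mapExactFunctor_extClass, mapExactFunctor_extClass]
      exact ShortComplex.ShortExact.extClass_naturality (hS.map_of_exact F)
        (hS.map_of_exact F') ((ShortComplex.mk i p w).mapNatTrans α)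
    rw [mapExactFunctor_comp, mapExactFunctor_comp, comp_assoc_of_third_deg_zero, key,
      ← comp_assoc_of_second_deg_zero, ih, comp_assoc (h₂₃ := rfl)]
    omega

theorem mapExactFunctor_functorComp [EnoughInjectives C] (F : C ⥤ D) (F' : D ⥤ E)
    [F.Additive] [PreservesFiniteLimits F] [PreservesFiniteColimits F]
    [F'.Additive] [PreservesFiniteLimits F'] [PreservesFiniteColimits F']
    [PreservesFiniteLimits (F ⋙ F')] [PreservesFiniteColimits (F ⋙ F')]
    {X Y : C} {n : ℕ} (x : Ext.{w} X Y n) :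
    x.mapExactFunctor (F ⋙ F') = (x.mapExactFunctor F).mapExactFunctor F' := by
  induction n generalizing Y with
  | zero =>
    obtain ⟨f, rfl⟩ := (mk₀_bijective X Y).2 x
    simp [mapExactFunctor_mk₀]
  | succ n ih =>
    obtain ⟨I, Q, i, p, w, hS, y, rfl⟩ := exists_eq_comp_extClass x
    have key : hS.extClass.mapExactFunctor (F ⋙ F') =
        (hS.extClass.mapExactFunctor F).mapExactFunctor F' := by
      rw [mapExactFunctor_extClass, mapExactFunctor_extClass]
      exact (mapExactFunctor_extClass F' (hS.map_of_exact F)).symm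
    rw [mapExactFunctor_comp, mapExactFunctor_comp, mapExactFunctor_comp, ih, key]

theorem mapExactFunctor_functorId [EnoughInjectives C] {X Y : C} {n : ℕ} (x : Ext.{w} X Y n) :
    x.mapExactFunctor (𝟭 C) = x := by
  induction n generalizing Y with
  | zero =>
    obtain ⟨f, rfl⟩ := (mk₀_bijective X Y).2 x
    simp [mapExactFunctor_mk₀]
  | succ n ih =>
    obtain ⟨I, Q, i, p, w, hS, y, rfl⟩ := exists_eq_comp_extClass x
    rw [mapExactFunctor_comp, mapExactFunctor_extClass, ih]
    rfl

end CategoryTheory.Abelian.Ext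

noncomputable section

namespace CrossedHochschild

open SkewMonoidAlgebra (single)

/-! ### The crossed product and the restriction functor -/

section CrossedProduct

variable (k : Type u) [Field k] (A : Type v) [Ring A] [Algebra k A]
  (G : Type v) [Group G] [MulSemiringAction G A] [SMulCommClass G k A]

/-- The inclusion of `A` into the crossed product, `a ↦ a 1`. -/
def coeffHom : A →ₐ[k] SkewMonoidAlgebra A G where
  __ := SkewMonoidAlgebra.singleOneRingHom
  commutes' _ := rfl

/-- The restriction of bimodules from the crossed product to `A`. -/
abbrev res : Bimod k (SkewMonoidAlgebra A G) ⥤ Bimod k A :=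
  ModuleCat.restrictScalars
    (Algebra.TensorProduct.map (coeffHom k A G) (AlgHom.op (coeffHom k A G))).toRingHom

/-- An element of `N`, seen in the restriction of `N`. -/
def toRes (N : Bimod k (SkewMonoidAlgebra A G)) : N ≃+ (res k A G).obj N := AddEquiv.refl N

variable {k A G}

theorem toRes_smul (N : Bimod k (SkewMonoidAlgebra A G)) (a b : A) (m : N) :
    (a ⊗ₜ[k] op b) • toRes k A G N m = toRes k A G N
      ((single (1 : G) a ⊗ₜ[k] op (single (1 : G) b)) • m) :=
  rfl

instance res_preservesFiniteLimits : Limits.PreservesFiniteLimits (res k A G) where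
  preservesFiniteLimits _ _ _ := ⟨inferInstance⟩

instance res_preservesFiniteColimits : Limits.PreservesFiniteColimits (res k A G) where
  preservesFiniteColimits _ _ _ := ⟨inferInstance⟩

instance res_linear : (res k A G).Linear k where
  map_smul {M N} f r := by
    ext m
    change algebraMap k (Env k (SkewMonoidAlgebra A G)) r • f.hom m =
      Algebra.TensorProduct.map (coeffHom k A G) (AlgHom.op (coeffHom k A G))
        (algebraMap k (Env k A) r) • f.hom m
    rw [AlgHom.commutes]

variable (k A) in
/-- The inclusion of the summand `Ag` into the crossed product. -/
def ofAg (g : G) : Ag k A g ⟶ (res k A G).obj (regular k (SkewMonoidAlgebra A G)) :=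
  homMk (((toRegular k (SkewMonoidAlgebra A G)).trans (toRes k A G _)).toAddMonoidHom.comp
      ((SkewMonoidAlgebra.singleAddHom g).comp (toAg k A g).symm.toAddMonoidHom))
    (fun a b m => by
      obtain ⟨x, rfl⟩ := (toAg k A g).surjective m
      rw [toAg_smul]
      change toRes k A G _ (toRegular k _ (single g (a * x * g • b))) =
        _ • toRes k A G _ (toRegular k _ (single g x))
      rw [toRes_smul, toRegular_smul]
      simp [SkewMonoidAlgebra.single_mul_single])

theorem ofAg_apply (g : G) (x : A) : ofAg k A g (toAg k A g x) =
    toRes k A G _ (toRegular k _ (single g x)) := rfl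

variable (k A) in
/-- The projection of the crossed product onto the summand `Ag`. -/
def coeffAg (g : G) : (res k A G).obj (regular k (SkewMonoidAlgebra A G)) ⟶ Ag k A g :=
  homMk ((toAg k A g).toAddMonoidHom.comp ((Finsupp.applyAddHom g).comp
      (((toRes k A G _).symm.trans (toRegular k (SkewMonoidAlgebra A G)).symm).trans
        SkewMonoidAlgebra.coeffAddEquiv).toAddMonoidHom))
    (fun a b m => by
      obtain ⟨m, rfl⟩ := (toRes k A G _).surjective m
      obtain ⟨x, rfl⟩ := (toRegular k _).surjective m
      rw [toRes_smul, toRegular_smul]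
      change toAg k A g (SkewMonoidAlgebra.coeff _ g) =
        _ • toAg k A g (SkewMonoidAlgebra.coeff x g)
      rw [toAg_smul]
      simp)

theorem coeffAg_apply (g : G) (b : SkewMonoidAlgebra A G) :
    coeffAg k A g (toRes k A G _ (toRegular k _ b)) = toAg k A g (b.coeff g) := rfl

theorem ofAg_comp_coeffAg (g : G) : ofAg k A g ≫ coeffAg k A g = 𝟙 _ := by
  ext m
  obtain ⟨x, rfl⟩ := (toAg k A g).surjective m
  change coeffAg k A g (ofAg k A g (toAg k A g x)) = toAg k A g x
  simp [ofAg_apply, coeffAg_apply, SkewMonoidAlgebra.coeff_single]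

theorem ofAg_comp_coeffAg_of_ne {g h : G} (hgh : g ≠ h) : ofAg k A g ≫ coeffAg k A h = 0 := by
  ext m
  obtain ⟨x, rfl⟩ := (toAg k A g).surjective m
  change coeffAg k A h (ofAg k A g (toAg k A g x)) = 0
  simp [ofAg_apply, coeffAg_apply, SkewMonoidAlgebra.coeff_single, hgh]

variable (k A G) in
/-- The inclusion of `A` into the crossed product, as a map of `A`-`A`-bimodules. -/
def unitRes : regular k A ⟶ (res k A G).obj (regular k (SkewMonoidAlgebra A G)) :=
  oneAg k A ≫ ofAg k A 1

theorem unitRes_apply (x : A) : unitRes k A G (toRegular k A x) =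
    toRes k A G _ (toRegular k _ (single 1 x)) := rfl

variable (k A) in
/-- Left multiplication by `g` on bimodules over the crossed product, `g ⊗ m ↦ g m`, as a map
`Ag ⊗_A N → N`. -/
def leftMul (g : G) : res k A G ⋙ tensorAg k A g ⟶ res k A G where
  app N := homMk ((toRes k A G N).toAddMonoidHom.comp ((DistribSMul.toAddMonoidHom N
        (single g (1 : A) ⊗ₜ[k] op (1 : SkewMonoidAlgebra A G))).comp
        ((toTwist _ _ _).symm.trans (toRes k A G N).symm).toAddMonoidHom))
    (fun a b m => by
      obtain ⟨m, rfl⟩ := (toTwist _ _ _).surjective m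
      obtain ⟨m, rfl⟩ := (toRes k A G N).surjective m
      rw [toTwist_smul, toRes_smul]
      change toRes k A G N ((single g (1 : A) ⊗ₜ[k] op (1 : SkewMonoidAlgebra A G)) •
        (single (1 : G) (g⁻¹ • a) ⊗ₜ[k] op (single (1 : G) b)) • m) = (a ⊗ₜ[k] op b) •
        toRes k A G N ((single g (1 : A) ⊗ₜ[k] op (1 : SkewMonoidAlgebra A G)) • m)
      rw [toRes_smul, smul_smul, smul_smul]
      simp [SkewMonoidAlgebra.single_mul_single, Algebra.TensorProduct.tmul_mul_tmul])
  naturality M N f := by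
    ext m
    exact (f.hom.map_smul _ _).symm

theorem leftMul_app_apply (g : G) (N : Bimod k (SkewMonoidAlgebra A G)) (m : N) :
    (leftMul k A g).app N (toTwist _ _ _ (toRes k A G N m)) =
      toRes k A G N ((single g (1 : A) ⊗ₜ[k] op (1 : SkewMonoidAlgebra A G)) • m) := rfl

variable (k A) in
/-- Conjugation `m ↦ s m s⁻¹` on bimodules over the crossed product. -/
def conjRes (s : G) : res k A G ⋙ conjTwist k A s ⟶ res k A G where
  app N := homMk ((toRes k A G N).toAddMonoidHom.comp ((DistribSMul.toAddMonoidHom N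
        (single s (1 : A) ⊗ₜ[k]
          op (single s⁻¹ (1 : A)))).comp
        ((toTwist _ _ _).symm.trans (toRes k A G N).symm).toAddMonoidHom))
    (fun a b m => by
      obtain ⟨m, rfl⟩ := (toTwist _ _ _).surjective m
      obtain ⟨m, rfl⟩ := (toRes k A G N).surjective m
      rw [toTwist_smul, toRes_smul]
      change toRes k A G N ((single s (1 : A) ⊗ₜ[k] op (single s⁻¹ (1 : A))) •
        (single (1 : G) (s⁻¹ • a) ⊗ₜ[k] op (single (1 : G) (s⁻¹ • b))) • m) = (a ⊗ₜ[k] op b) •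
        toRes k A G N ((single s (1 : A) ⊗ₜ[k] op (single s⁻¹ (1 : A))) • m)
      rw [toRes_smul, smul_smul, smul_smul]
      simp [SkewMonoidAlgebra.single_mul_single, Algebra.TensorProduct.tmul_mul_tmul, ← op_mul])
  naturality M N f := by
    ext m
    exact (f.hom.map_smul _ _).symm

theorem conjRes_app_apply (s : G) (N : Bimod k (SkewMonoidAlgebra A G)) (m : N) :
    (conjRes k A s).app N (toTwist _ _ _ (toRes k A G N m)) =
      toRes k A G N ((single s (1 : A) ⊗ₜ[k]
          op (single s⁻¹ (1 : A))) • m) := rfl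

/-- The inclusion of `Ag` is `x g ↦ g ⊗ g⁻¹(x) ↦ g g⁻¹(x) = x g`. -/
theorem rightUnitor_comp_leftMul (g : G) :
    rightUnitor k A g ≫ (tensorAg k A g).map (unitRes k A G) ≫ (leftMul k A g).app _ =
      ofAg k A g := by
  ext m
  obtain ⟨x, rfl⟩ := (toAg k A g).surjective m
  change (leftMul k A g).app _ (toTwist _ _ _ (toRes k A G _
    (toRegular k _ (single 1 (g⁻¹ • x))))) = _
  rw [leftMul_app_apply, toRegular_smul, ofAg_apply]
  simp [SkewMonoidAlgebra.single_mul_single]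

theorem tensorAg_map_ofAg_comp_leftMul (g h : G) :
    (tensorAg k A g).map (ofAg k A h) ≫ (leftMul k A g).app _ =
      mulAg k A g h ≫ ofAg k A (g * h) := by
  ext m
  obtain ⟨m, rfl⟩ := (toTwist _ _ _).surjective m
  obtain ⟨x, rfl⟩ := (toAg k A h).surjective m
  change (leftMul k A g).app _ (toTwist _ _ _ (toRes k A G _
    (toRegular k _ (single h x)))) = ofAg k A (g * h) (toAg k A (g * h) (g • x))
  rw [leftMul_app_apply, toRegular_smul, ofAg_apply]
  simp [SkewMonoidAlgebra.single_mul_single]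

theorem conjSource_comp_conjRes (s : G) :
    conjSource k A s ≫ (conjTwist k A s).map (unitRes k A G) ≫ (conjRes k A s).app _ =
      unitRes k A G := by
  ext m
  obtain ⟨x, rfl⟩ := (toRegular k A).surjective m
  change (conjRes k A s).app _ (toTwist _ _ _ (toRes k A G _
    (toRegular k _ (single 1 (s⁻¹ • x))))) = _
  rw [conjRes_app_apply, toRegular_smul, unitRes_apply]
  simp [SkewMonoidAlgebra.single_mul_single]

theorem conjTwist_map_ofAg_comp_conjRes (s g : G) :
    (conjTwist k A s).map (ofAg k A g) ≫ (conjRes k A s).app _ =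
      conjTarget k A s g ≫ ofAg k A (s * g * s⁻¹) := by
  ext m
  obtain ⟨m, rfl⟩ := (toTwist _ _ _).surjective m
  obtain ⟨x, rfl⟩ := (toAg k A g).surjective m
  change (conjRes k A s).app _ (toTwist _ _ _ (toRes k A G _
    (toRegular k _ (single g x)))) =
      ofAg k A (s * g * s⁻¹) (toAg k A (s * g * s⁻¹) (s • x))
  rw [conjRes_app_apply, toRegular_smul, ofAg_apply]
  simp [SkewMonoidAlgebra.single_mul_single]

variable [Fintype G]

theorem sum_coeffAg_comp_ofAg : ∑ g : G, coeffAg k A g ≫ ofAg k A g = 𝟙 _ := by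
  ext m
  obtain ⟨m, rfl⟩ := (toRes k A G _).surjective m
  obtain ⟨x, rfl⟩ := (toRegular k _).surjective m
  rw [ModuleCat.hom_sum, LinearMap.sum_apply]
  change ∑ g : G, toRes k A G _ (toRegular k _ (single g (x.coeff g))) = _
  rw [← map_sum, ← map_sum]
  change _ = toRes k A G _ (toRegular k _ x)
  congr 2
  conv_rhs => rw [← SkewMonoidAlgebra.sum_single x]
  exact (Finsupp.sum_fintype x.coeff (fun g a => single g a) (by simp)).symm

end CrossedProduct

/-! ### Matrices over bimodules -/

section Matrices

variable (k : Type u) [Field k] (A : Type v) [Ring A] [Algebra k A]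
  (G : Type v) [Group G] [Fintype G] [DecidableEq G] [MulSemiringAction G A] [SMulCommClass G k A]

/-- The representation of the crossed product by matrices over `A`, on the free right `A`-module
`A ⋊ G = ⨁ x, x A`. The entry of `a g` at `(g y, y)` is `(g y)⁻¹(a)`, the other entries vanish. -/
def matrixRep : SkewMonoidAlgebra A G →ₐ[k] Matrix G G A :=
  SkewMonoidAlgebra.liftNCAlgHom
    ((Matrix.diagonalAlgHom k).comp (AlgHom.pi fun x : G => act k A x⁻¹))
    { toFun g := Matrix.of fun x y => if x = g * y then 1 else 0
      map_one' := by
        ext x y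
        simp [Matrix.one_apply]
      map_mul' g h := by
        ext x y
        simp [Matrix.mul_apply, mul_assoc] }
    (by
      intro a g
      ext x y
      by_cases h : x = g * y <;> simp [Matrix.diagonal_mul, Matrix.mul_diagonal, h, mul_smul])

variable {A G} in
theorem matrixRep_single (g : G) (a : A) (x y : G) :
    matrixRep k A G (single g a) x y = if x = g * y then x⁻¹ • a else 0 := by
  refine (congrFun₂ (SkewMonoidAlgebra.liftNC_single (R := Matrix G G A) _ _ g a) x y).trans ?_
  change (Matrix.diagonal (fun x : G => x⁻¹ • a) *
    Matrix.of fun x y : G => if x = g * y then (1 : A) else 0) x y = _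
  simp [Matrix.diagonal_mul]

variable {A G} in
/-- The elements `x` of the crossed product form a right basis in which `matrixRep` gives left
multiplication. -/
theorem sum_single_mul_matrixRep (b : SkewMonoidAlgebra A G) (y : G) :
    ∑ x : G, single x (1 : A) * single 1 (matrixRep k A G b x y) = b * single y 1 := by
  induction b using SkewMonoidAlgebra.induction_on with
  | zero => simp
  | single g a =>
    rw [Finset.sum_eq_single (g * y)]
    · simp [matrixRep_single, SkewMonoidAlgebra.single_mul_single, smul_smul]
    · intro x _ hx
      simp [matrixRep_single, hx]
    · simp
  | add b c hb hc =>
    simp only [map_add, Matrix.add_apply, SkewMonoidAlgebra.single_add, mul_add,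
      Finset.sum_add_distrib, hb, hc, add_mul]

variable {A G} in
/-- The elements `y⁻¹` of the crossed product form a left basis in which `matrixRep` gives right
multiplication. -/
theorem sum_matrixRep_mul_single (b : SkewMonoidAlgebra A G) (x : G) :
    ∑ y : G, single 1 (matrixRep k A G b x y) * single y⁻¹ (1 : A) = single x⁻¹ 1 * b := by
  induction b using SkewMonoidAlgebra.induction_on with
  | zero => simp
  | single g a =>
    rw [Finset.sum_eq_single (g⁻¹ * x)]
    · simp [matrixRep_single, SkewMonoidAlgebra.single_mul_single]
    · intro y _ hy
      have : x ≠ g * y := fun h => hy (by simp [h])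
      simp [matrixRep_single, this]
    · simp
  | add b c hb hc =>
    simp only [map_add, Matrix.add_apply, SkewMonoidAlgebra.single_add, mul_add,
      Finset.sum_add_distrib, hb, hc, add_mul]

/-- The map on enveloping algebras given by `matrixRep` on both factors, where matrices with entries
in a bimodule are read as vectors indexed by `G × G`. -/
def envMatrixRep : Env k (SkewMonoidAlgebra A G) →ₐ[k] Matrix (G × G) (G × G) (Env k A) :=
  (Matrix.kroneckerTMulAlgEquiv G G k k A Aᵐᵒᵖ).toAlgHom.comp
    (Algebra.TensorProduct.map (matrixRep k A G)
      ((AlgEquiv.mopMatrix (m := G) (R := k) (α := A)).symm.toAlgHom.comp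
        (AlgHom.op (matrixRep k A G))))

/-- The functor that takes an `A`-`A`-bimodule `M` to the square matrices with entries in `M`, on
which the crossed product acts on both sides through `matrixRep`. It is exact because passing to
matrices is an equivalence onto bimodules over a matrix algebra, and restriction of scalars is
exact. -/
def matrices : Bimod k A ⥤ Bimod k (SkewMonoidAlgebra A G) :=
  (ModuleCat.matrixEquivalence (Env k A) ((1, 1) : G × G)).functor ⋙
    ModuleCat.restrictScalars (envMatrixRep k A G).toRingHom

instance : (matrices k A G).Additive where
  map_add := rfl

instance : Limits.PreservesFiniteLimits (matrices k A G) := by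
  have : Limits.PreservesFiniteLimits
      (ModuleCat.restrictScalars.{v} (envMatrixRep k A G).toRingHom) :=
    { preservesFiniteLimits _ _ _ := ⟨inferInstance⟩ }
  exact Limits.comp_preservesFiniteLimits _ _

instance : Limits.PreservesFiniteColimits (matrices k A G) := by
  have : Limits.PreservesFiniteColimits
      (ModuleCat.restrictScalars.{v} (envMatrixRep k A G).toRingHom) :=
    { preservesFiniteColimits _ _ _ := ⟨inferInstance⟩ }
  exact Limits.comp_preservesFiniteColimits _ _

variable {k A} in
/-- A family of elements of `M`, seen as a matrix. -/
def toMatrices (M : Bimod k A) : (G × G → M) ≃+ (matrices k A G).obj M := AddEquiv.refl _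

variable {k A G}

theorem toMatrices_smul (M : Bimod k A) (b c : SkewMonoidAlgebra A G) (f : G × G → M) :
    (b ⊗ₜ[k] op c) • toMatrices G M f = toMatrices G M fun p => ∑ q : G × G,
      (matrixRep k A G b p.1 q.1 ⊗ₜ[k] op (matrixRep k A G c q.2 p.2)) • f q := by
  apply (toMatrices G M).symm.injective
  ext p
  exact Matrix.Module.smul_apply (envMatrixRep k A G (b ⊗ₜ[k] op c)) f p

end Matrices

/-! ### Separability of the crossed product over the coefficients -/

section Transfer

variable (k : Type u) [Field k] (A : Type v) [Ring A] [Algebra k A]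
  (G : Type v) [Group G] [Fintype G] [DecidableEq G] [MulSemiringAction G A] [SMulCommClass G k A]

/-- The map `f ↦ ∑ x y, x f(x, y) y⁻¹` from the matrices over the restriction of a bimodule `N` to
`N`. -/
def collapse : res k A G ⋙ matrices k A G ⟶ 𝟭 (Bimod k (SkewMonoidAlgebra A G)) where
  app N := homMk
    { toFun m := ∑ p : G × G, (single p.1 (1 : A) ⊗ₜ[k] op (single p.2⁻¹ (1 : A))) •
        (toRes k A G N).symm ((toMatrices G ((res k A G).obj N)).symm m p)
      map_zero' := by simp
      map_add' m n := by simp [smul_add, Finset.sum_add_distrib] }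
    (fun b c m => by
      obtain ⟨f, rfl⟩ := (toMatrices G ((res k A G).obj N)).surjective m
      -- Read the entries, elements of the restriction of `N`, as elements of `N`.
      obtain ⟨f, rfl⟩ : ∃ f' : G × G → N, (fun p => toRes k A G N (f' p)) = f := ⟨f, rfl⟩
      rw [toMatrices_smul]
      change ∑ p : G × G, (single p.1 (1 : A) ⊗ₜ[k] op (single p.2⁻¹ (1 : A))) •
          (toRes k A G N).symm (∑ q : G × G, (matrixRep k A G b p.1 q.1 ⊗ₜ[k]
            op (matrixRep k A G c q.2 p.2)) • toRes k A G N (f q)) =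
        (b ⊗ₜ[k] op c) • ∑ p : G × G,
          (single p.1 (1 : A) ⊗ₜ[k] op (single p.2⁻¹ (1 : A))) • f p
      simp only [toRes_smul, map_sum, Finset.smul_sum, AddEquiv.symm_apply_apply, smul_smul]
      rw [Finset.sum_comm]
      refine Finset.sum_congr rfl fun q _ => ?_
      -- Compare coefficients of `f q` in the enveloping algebra; both factors are given by the
      -- two lemmas on the bases `x` and `y⁻¹`.
      rw [← Finset.sum_smul]
      congr 1
      simp only [Algebra.TensorProduct.tmul_mul_tmul, ← op_mul]
      rw [← sum_single_mul_matrixRep k, ← sum_matrixRep_mul_single k, Fintype.sum_prod_type,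
        TensorProduct.sum_tmul]
      refine Finset.sum_congr rfl fun x _ => ?_
      rw [Finset.op_sum, TensorProduct.tmul_sum])
  naturality M N f := by
    ext m
    change ∑ p : G × G, (single p.1 (1 : A) ⊗ₜ[k] op (single p.2⁻¹ (1 : A))) • f.hom (m p) =
      f.hom (∑ p : G × G, (single p.1 (1 : A) ⊗ₜ[k] op (single p.2⁻¹ (1 : A))) • _)
    rw [map_sum]
    refine Finset.sum_congr rfl fun p _ => ?_
    exact (f.hom.map_smul _ _).symm

variable {G} in
/-- The inclusion of a bimodule, twisted by `x`, as the diagonal entry at `x` of matrices. -/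
def diagonalEntry (x : G) : conjTwist k A x ⟶ matrices k A G ⋙ res k A G where
  app M := homMk ((toRes k A G _).toAddMonoidHom.comp ((toMatrices G M).toAddMonoidHom.comp
      ((AddMonoidHom.single (fun _ : G × G => M) (x, x)).comp
        (toTwist _ _ M).symm.toAddMonoidHom)))
    (fun a b m => by
      obtain ⟨m, rfl⟩ := (toTwist _ _ _).surjective m
      rw [toTwist_smul]
      change toRes k A G _ (toMatrices G M (Pi.single (x, x) _)) =
        (a ⊗ₜ[k] op b) • toRes k A G _ (toMatrices G M (Pi.single (x, x) m))
      rw [toRes_smul, toMatrices_smul]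
      congr 2
      ext p
      rw [Finset.sum_eq_single (x, x)]
      · obtain ⟨y, z⟩ := p
        by_cases hy : y = x
        · by_cases hz : x = z
          · subst hy hz
            simp [matrixRep_single]
          · have hp : ((y, z) : G × G) ≠ (x, x) := fun h => hz (Prod.ext_iff.1 h).2.symm
            simp only [matrixRep_single, Pi.single_eq_same, Pi.single_eq_of_ne hp, one_mul,
              if_neg hz, op_zero, TensorProduct.tmul_zero]
            exact (zero_smul (Env k A) m).symm
        · have hp : ((y, z) : G × G) ≠ (x, x) := fun h => hy (Prod.ext_iff.1 h).1
          simp only [matrixRep_single, Pi.single_eq_same, Pi.single_eq_of_ne hp, one_mul,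
            if_neg hy, TensorProduct.zero_tmul]
          exact (zero_smul (Env k A) m).symm
      · intro q _ hq
        simp [hq]
      · simp)
  naturality M N f := by
    ext m
    obtain ⟨m, rfl⟩ := (toTwist _ _ _).surjective m
    change toRes k A G _ (toMatrices G N (Pi.single (x, x) (f m))) =
      toRes k A G _ (toMatrices G N fun p => f ((Pi.single (x, x) m : G × G → M) p))
    congr 2
    ext p
    by_cases hp : p = (x, x)
    · subst hp; simp
    · simp [hp]

/-- The map from the crossed product to matrices over `A` given by `matrixRep`. -/
def toMatricesRegular :
    regular k (SkewMonoidAlgebra A G) ⟶ (matrices k A G).obj (regular k A) :=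
  homMk
    { toFun b := toMatrices G _ fun p =>
        toRegular k A (matrixRep k A G ((toRegular k _).symm b) p.1 p.2)
      map_zero' := by
        simp
        rfl
      map_add' b c := by
        simp
        rfl }
    (fun a b m => by
      obtain ⟨c, rfl⟩ := (toRegular k _).surjective m
      rw [toRegular_smul]
      change toMatrices G _ (fun p => toRegular k A (matrixRep k A G (a * c * b) p.1 p.2)) =
        _ • toMatrices G _ (fun p => toRegular k A (matrixRep k A G c p.1 p.2))
      rw [toMatrices_smul]
      congr 1
      ext p
      simp only [toRegular_smul, ← map_sum]
      congr 1
      simp only [map_mul, Matrix.mul_apply, Finset.sum_mul, Fintype.sum_prod_type]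
      rw [Finset.sum_comm])

variable {k A G}

theorem collapse_app_apply (N : Bimod k (SkewMonoidAlgebra A G)) (f : G × G → N) :
    (collapse k A G).app N (toMatrices G _ fun p => toRes k A G N (f p)) =
      ∑ p : G × G, (single p.1 (1 : A) ⊗ₜ[k] op (single p.2⁻¹ (1 : A))) • f p := rfl

/-- The composite takes `b` to `∑ x y, x (matrixRep b)(x, y) y⁻¹ = ∑ x, x x⁻¹ b`. This is the
separability of the crossed product over `A` when `|G|` is invertible. -/
theorem toMatricesRegular_comp_collapse :
    toMatricesRegular k A G ≫ (matrices k A G).map (unitRes k A G) ≫ (collapse k A G).app _ =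
      (Fintype.card G : k) • 𝟙 _ := by
  ext m
  obtain ⟨b, rfl⟩ := (toRegular k _).surjective m
  change (collapse k A G).app _ (toMatrices G _ fun p => toRes k A G _
    (toRegular k _ (single 1 (matrixRep k A G b p.1 p.2)))) =
      algebraMap k (Env k (SkewMonoidAlgebra A G)) (Fintype.card G) • toRegular k _ b
  rw [collapse_app_apply, Algebra.TensorProduct.algebraMap_apply, ← op_one, toRegular_smul]
  simp only [toRegular_smul, ← map_sum, Fintype.sum_prod_type, mul_assoc, ← Finset.mul_sum,
    sum_matrixRep_mul_single]
  simp [← mul_assoc, SkewMonoidAlgebra.single_mul_single]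

/-- The matrix that represents `a ∈ A` is diagonal, with entries `x⁻¹(a)`. -/
theorem unitRes_comp_toMatricesRegular :
    unitRes k A G ≫ (res k A G).map (toMatricesRegular k A G) =
      ∑ x : G, conjSource k A x ≫ (diagonalEntry k A x).app _ := by
  ext m
  obtain ⟨a, rfl⟩ := (toRegular k _).surjective m
  rw [ModuleCat.hom_sum, LinearMap.sum_apply]
  change toRes k A G _ (toMatrices G _ fun p =>
    toRegular k A (matrixRep k A G (single 1 a) p.1 p.2)) =
    ∑ x : G, toRes k A G _ (toMatrices G _ (Pi.single (x, x) (toRegular k A (x⁻¹ • a))))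
  rw [← map_sum, ← map_sum]
  congr 2
  ext p
  obtain ⟨y, z⟩ := p
  rw [Finset.sum_apply, Finset.sum_eq_single y]
  · by_cases hz : y = z
    · subst hz; simp [matrixRep_single]
    · simp [matrixRep_single, hz, eq_comm (a := z)]
  · intro x _ hx
    simp [hx.symm]
  · simp

theorem diagonalEntry_comp_collapse (x : G) (N : Bimod k (SkewMonoidAlgebra A G)) :
    (diagonalEntry k A x).app _ ≫ (res k A G).map ((collapse k A G).app N) =
      (conjRes k A x).app N := by
  ext m
  obtain ⟨m, rfl⟩ := (toTwist _ _ _).surjective m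
  obtain ⟨m, rfl⟩ := (toRes k A G N).surjective m
  rw [conjRes_app_apply]
  change toRes k A G N ((collapse k A G).app N (toMatrices G _ fun p =>
    toRes k A G N ((Pi.single (x, x) m : G × G → N) p))) = _
  congr 1
  rw [collapse_app_apply, Finset.sum_eq_single (x, x)]
  · simp
  · intro q _ hq
    simp [hq]
  · simp

end Transfer

/-! ### Hochschild cohomology -/

section Comparison

variable (k : Type u) [Field k] (A : Type v) [Ring A] [Algebra k A]
  {G : Type v} [Group G] [MulSemiringAction G A] [SMulCommClass G k A]

variable (G) in
/-- Restriction of Hochschild classes of the crossed product to `A`. -/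
def resHH (N : Bimod k (SkewMonoidAlgebra A G)) (n : ℕ) :
    HH k (SkewMonoidAlgebra A G) N n →ₗ[k] HH k A ((res k A G).obj N) n where
  toFun y := (Abelian.Ext.mk₀ (unitRes k A G)).comp (y.mapExactFunctor (res k A G)) (zero_add n)
  map_add' x y := by simp
  map_smul' r x := by simp

/-- The action of `s` on `HH(A, N)` for a bimodule `N` over the crossed product, by transport of
structure and conjugation in `N`. -/
def conjResHH (N : Bimod k (SkewMonoidAlgebra A G)) (n : ℕ) (s : G) :
    HH k A ((res k A G).obj N) n →ₗ[k] HH k A ((res k A G).obj N) n where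
  toFun x := (Abelian.Ext.mk₀ (conjSource k A s)).comp
    ((x.mapExactFunctor (conjTwist k A s)).comp
      (Abelian.Ext.mk₀ ((conjRes k A s).app N)) (add_zero n)) (zero_add n)
  map_add' x y := by simp
  map_smul' r x := by simp

variable {k A}

theorem conjHH_apply {n : ℕ} (s g : G) (x : HH k A (Ag k A g) n) : conjHH k A s g n x =
    (Abelian.Ext.mk₀ (conjSource k A s)).comp ((x.mapExactFunctor (conjTwist k A s)).comp
      (Abelian.Ext.mk₀ (conjTarget k A s g)) (add_zero n)) (zero_add n) := rfl

theorem resHH_apply {N : Bimod k (SkewMonoidAlgebra A G)} {n : ℕ}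
    (y : HH k (SkewMonoidAlgebra A G) N n) : resHH k A G N n y =
      (Abelian.Ext.mk₀ (unitRes k A G)).comp (y.mapExactFunctor (res k A G)) (zero_add n) := rfl

theorem conjResHH_apply {N : Bimod k (SkewMonoidAlgebra A G)} {n : ℕ} (s : G)
    (x : HH k A ((res k A G).obj N) n) : conjResHH k A N n s x =
      (Abelian.Ext.mk₀ (conjSource k A s)).comp ((x.mapExactFunctor (conjTwist k A s)).comp
        (Abelian.Ext.mk₀ ((conjRes k A s).app N)) (add_zero n)) (zero_add n) := rfl

/-- Restricted classes are invariant, since conjugation fixes the unit of the crossed product and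
is natural in bimodules over it. -/
theorem conjResHH_resHH {N : Bimod k (SkewMonoidAlgebra A G)} {n : ℕ} (s : G)
    (y : HH k (SkewMonoidAlgebra A G) N n) :
    conjResHH k A N n s (resHH k A G N n y) = resHH k A G N n y := by
  rw [conjResHH_apply, resHH_apply, Abelian.Ext.mapExactFunctor_comp,
    Abelian.Ext.mapExactFunctor_mk₀,
    Abelian.Ext.comp_assoc_of_third_deg_zero, ← Abelian.Ext.mapExactFunctor_functorComp,
    Abelian.Ext.mapExactFunctor_naturality _ _ (conjRes k A s)]
  dsimp only [Functor.comp_obj]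
  rw [Abelian.Ext.mk₀_comp_mk₀_assoc, Abelian.Ext.mk₀_comp_mk₀_assoc,
    Category.assoc, conjSource_comp_conjRes s]

theorem resHH_comp {N : Bimod k (SkewMonoidAlgebra A G)} {p q : ℕ}
    (x : HH k (SkewMonoidAlgebra A G) (regular k (SkewMonoidAlgebra A G)) p)
    (y : HH k (SkewMonoidAlgebra A G) N q) :
    resHH k A G N (p + q) (x.comp y rfl) =
      (resHH k A G _ p x).comp (y.mapExactFunctor (res k A G)) rfl := by
  rw [resHH_apply, resHH_apply, Abelian.Ext.mapExactFunctor_comp]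
  exact (Abelian.Ext.comp_assoc _ _ _ (zero_add p) rfl (by omega)).symm

/-- In the crossed product, the horizontal product can be computed with left multiplication. -/
theorem mulHH_comp_ofAg {g h : G} {p q : ℕ} (x : HH k A (Ag k A g) p) (y : HH k A (Ag k A h) q) :
    (mulHH x y).comp (Abelian.Ext.mk₀ (ofAg k A (g * h))) (add_zero (p + q)) =
      x.comp ((Abelian.Ext.mk₀ (rightUnitor k A g)).comp
        (((y.comp (Abelian.Ext.mk₀ (ofAg k A h)) (add_zero q)).mapExactFunctor
          (tensorAg k A g)).comp (Abelian.Ext.mk₀ ((leftMul k A g).app _)) (add_zero q))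
        (zero_add q)) rfl := by
  rw [mulHH, Abelian.Ext.comp_assoc_of_third_deg_zero, Abelian.Ext.comp_assoc_of_third_deg_zero,
    Abelian.Ext.comp_assoc_of_third_deg_zero, Abelian.Ext.mk₀_comp_mk₀,
    ← tensorAg_map_ofAg_comp_leftMul, Abelian.Ext.mapExactFunctor_comp,
    Abelian.Ext.mapExactFunctor_mk₀, Abelian.Ext.comp_assoc_of_third_deg_zero,
    ← Abelian.Ext.mk₀_comp_mk₀]

/-- Multiplying a restricted class by `g` from the left is the same as composing it with the
inclusion of `Ag`. -/
theorem tensorAg_resHH_comp_leftMul {N : Bimod k (SkewMonoidAlgebra A G)} {n : ℕ} (g : G)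
    (y : HH k (SkewMonoidAlgebra A G) N n) :
    (Abelian.Ext.mk₀ (rightUnitor k A g)).comp (((resHH k A G N n y).mapExactFunctor
      (tensorAg k A g)).comp (Abelian.Ext.mk₀ ((leftMul k A g).app N)) (add_zero n)) (zero_add n) =
    (Abelian.Ext.mk₀ (ofAg k A g)).comp (y.mapExactFunctor (res k A G)) (zero_add n) := by
  rw [resHH_apply, Abelian.Ext.mapExactFunctor_comp, Abelian.Ext.mapExactFunctor_mk₀,
    Abelian.Ext.comp_assoc_of_third_deg_zero, ← Abelian.Ext.mapExactFunctor_functorComp,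
    Abelian.Ext.mapExactFunctor_naturality _ _ (leftMul k A g)]
  dsimp only [Functor.comp_obj]
  rw [Abelian.Ext.mk₀_comp_mk₀_assoc, Abelian.Ext.mk₀_comp_mk₀_assoc,
    ← rightUnitor_comp_leftMul g, Category.assoc]

variable [Fintype G]

section
variable [DecidableEq G]

variable (k A G) in
/-- The transfer from the cohomology of `A` to that of the crossed product, not divided by
`|G|`. -/
def transferHH (N : Bimod k (SkewMonoidAlgebra A G)) (n : ℕ) (x : HH k A ((res k A G).obj N) n) :
    HH k (SkewMonoidAlgebra A G) N n :=
  (Abelian.Ext.mk₀ (toMatricesRegular k A G)).comp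
    ((x.mapExactFunctor (matrices k A G)).comp
      (Abelian.Ext.mk₀ ((collapse k A G).app N)) (add_zero n)) (zero_add n)

theorem transferHH_resHH {N : Bimod k (SkewMonoidAlgebra A G)} {n : ℕ}
    (y : HH k (SkewMonoidAlgebra A G) N n) :
    transferHH k A G N n (resHH k A G N n y) = (Fintype.card G : k) • y := by
  rw [transferHH, resHH_apply, Abelian.Ext.mapExactFunctor_comp, Abelian.Ext.mapExactFunctor_mk₀,
    Abelian.Ext.comp_assoc_of_third_deg_zero, ← Abelian.Ext.mapExactFunctor_functorComp,
    Abelian.Ext.mapExactFunctor_naturality _ _ (collapse k A G)]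
  dsimp only [Functor.comp_obj]
  rw [Abelian.Ext.mk₀_comp_mk₀_assoc, Abelian.Ext.mk₀_comp_mk₀_assoc, Category.assoc,
    toMatricesRegular_comp_collapse, Abelian.Ext.mapExactFunctor_functorId, Abelian.Ext.mk₀_smul,
    Abelian.Ext.smul_comp]
  exact congrArg _ (Abelian.Ext.mk₀_id_comp y)

/-- Restriction after transfer is the sum over all conjugates. -/
theorem resHH_transferHH {N : Bimod k (SkewMonoidAlgebra A G)} {n : ℕ}
    (x : HH k A ((res k A G).obj N) n) :
    resHH k A G N n (transferHH k A G N n x) = ∑ s : G, conjResHH k A N n s x := by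
  rw [resHH_apply, transferHH, Abelian.Ext.mapExactFunctor_comp, Abelian.Ext.mapExactFunctor_comp,
    Abelian.Ext.mapExactFunctor_mk₀, Abelian.Ext.mapExactFunctor_mk₀,
    Abelian.Ext.mk₀_comp_mk₀_assoc, unitRes_comp_toMatricesRegular, Abelian.Ext.mk₀_sum,
    Abelian.Ext.sum_comp]
  refine Finset.sum_congr rfl fun s _ => ?_
  rw [conjResHH_apply, ← Abelian.Ext.mk₀_comp_mk₀_assoc, ← diagonalEntry_comp_collapse,
    ← Abelian.Ext.mk₀_comp_mk₀,
    ← Abelian.Ext.comp_assoc_of_second_deg_zero (x.mapExactFunctor (conjTwist k A s)),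
    Abelian.Ext.mapExactFunctor_naturality _ _ (diagonalEntry k A s),
    Abelian.Ext.mapExactFunctor_functorComp]
  congr 1
  exact (Abelian.Ext.comp_assoc_of_third_deg_zero _ _ _ _).symm

end

variable (k A G) in
/-- The decomposition of `HH(A, A ⋊ G)` given by `A ⋊ G = ⨁ g, Ag`. -/
def totalHH (n : ℕ) : TwistedHH k A G n ≃ₗ[k]
    HH k A ((res k A G).obj (regular k (SkewMonoidAlgebra A G))) n :=
  (DirectSum.linearEquivFunOnFintype k G _).trans
    { toFun f := ∑ g : G, (f g).comp (Abelian.Ext.mk₀ (ofAg k A g)) (add_zero n)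
      map_add' f f' := by simp [Finset.sum_add_distrib]
      map_smul' r f := by simp [Finset.smul_sum]
      invFun x g := x.comp (Abelian.Ext.mk₀ (coeffAg k A g)) (add_zero n)
      left_inv f := by
        ext h : 1
        dsimp only
        rw [Abelian.Ext.sum_comp, Finset.sum_eq_single h]
        · simp [ofAg_comp_coeffAg]
        · intro g _ hg
          simp [ofAg_comp_coeffAg_of_ne hg]
        · simp
      right_inv x := by
        simp [← Abelian.Ext.comp_sum, ← Abelian.Ext.mk₀_sum, sum_coeffAg_comp_ofAg] }

theorem totalHH_apply {n : ℕ} (x : TwistedHH k A G n) : totalHH k A G n x =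
    ∑ g : G, (x g).comp (Abelian.Ext.mk₀ (ofAg k A g)) (add_zero n) := rfl

open scoped Classical in
theorem totalHH_of {n : ℕ} (g : G) (x : HH k A (Ag k A g) n) :
    totalHH k A G n (DirectSum.of (fun g => HH k A (Ag k A g) n) g x) =
      x.comp (Abelian.Ext.mk₀ (ofAg k A g)) (add_zero n) := by
  rw [totalHH_apply, Finset.sum_eq_single g]
  · rw [DirectSum.of_eq_same]
  · intro h _ hh
    rw [DirectSum.of_eq_of_ne _ _ _ hh, Abelian.Ext.zero_comp]
  · simp

theorem totalHH_oneTwistedHH :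
    totalHH k A G 0 oneTwistedHH = resHH k A G _ 0 (Abelian.Ext.mk₀ (𝟙 _)) := by
  rw [resHH_apply, oneTwistedHH, totalHH_of, Abelian.Ext.mk₀_comp_mk₀,
    Abelian.Ext.mapExactFunctor_mk₀,
    Abelian.Ext.mk₀_comp_mk₀, CategoryTheory.Functor.map_id, Category.comp_id]
  rfl

/-- The decomposition is equivariant: `s (Ag) s⁻¹ = A(s g s⁻¹)` in the crossed product. -/
theorem totalHH_conjTwistedHH {n : ℕ} (s : G) (x : TwistedHH k A G n) :
    totalHH k A G n (conjTwistedHH k A n s x) = conjResHH k A _ n s (totalHH k A G n x) := by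
  classical
  suffices h : (totalHH k A G n).toLinearMap ∘ₗ conjTwistedHH k A n s =
      conjResHH k A _ n s ∘ₗ (totalHH k A G n).toLinearMap from LinearMap.congr_fun h x
  refine DirectSum.linearMap_ext k fun g => LinearMap.ext fun y => ?_
  change totalHH k A G n (conjTwistedHH k A n s (DirectSum.lof k G _ g y)) =
    conjResHH k A _ n s (totalHH k A G n (DirectSum.lof k G _ g y))
  rw [conjTwistedHH, DirectSum.toModule_lof, LinearMap.comp_apply]
  refine (totalHH_of _ _).trans (Eq.trans ?_ (congrArg _ (totalHH_of g y).symm))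
  rw [conjResHH_apply, Abelian.Ext.mapExactFunctor_comp, Abelian.Ext.mapExactFunctor_mk₀,
    Abelian.Ext.comp_assoc_of_third_deg_zero, Abelian.Ext.mk₀_comp_mk₀,
    conjTwist_map_ofAg_comp_conjRes, ← Abelian.Ext.mk₀_comp_mk₀, conjHH_apply,
    Abelian.Ext.comp_assoc_of_third_deg_zero, Abelian.Ext.comp_assoc_of_third_deg_zero]

/-- The horizontal product with a class that comes from the crossed product by restriction is the
Yoneda product with the restriction. -/
theorem totalHH_mulTwistedHH {p q : ℕ} (x : TwistedHH k A G p) (y : TwistedHH k A G q)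
    (z : HH k (SkewMonoidAlgebra A G) (regular k (SkewMonoidAlgebra A G)) q)
    (hz : totalHH k A G q y = resHH k A G _ q z) :
    totalHH k A G (p + q) (mulTwistedHH x y) =
      (totalHH k A G p x).comp (z.mapExactFunctor (res k A G)) rfl := by
  rw [mulTwistedHH, map_sum, totalHH_apply x, Abelian.Ext.sum_comp]
  refine Finset.sum_congr rfl fun g _ => ?_
  rw [Abelian.Ext.comp_assoc_of_second_deg_zero, ← tensorAg_resHH_comp_leftMul, ← hz,
    totalHH_apply y, map_sum]
  simp only [totalHH_of, mulHH_comp_ofAg]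
  rw [← Functor.mapExtAddHom_apply, map_sum, Abelian.Ext.sum_comp, Abelian.Ext.comp_sum,
    Abelian.Ext.comp_sum]
  rfl

variable (k A G) in
/-- Restriction to `A` and decomposition, as an isomorphism from the cohomology of the crossed
product onto the invariants. Its inverse is the transfer, divided by `|G|`. -/
def equivInvariants (hG : (Fintype.card G : k) ≠ 0) (n : ℕ) :
    HH k (SkewMonoidAlgebra A G) (regular k (SkewMonoidAlgebra A G)) n ≃ₗ[k]
      invariants k A G n where
  __ := ((totalHH k A G n).symm.toLinearMap ∘ₗ resHH k A G _ n).codRestrict (invariants k A G n)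
    fun y s => (totalHH k A G n).injective <| by
      rw [totalHH_conjTwistedHH, LinearMap.comp_apply, LinearEquiv.coe_coe,
        LinearEquiv.apply_symm_apply, conjResHH_resHH]
  invFun x := letI := Classical.decEq G
    (Fintype.card G : k)⁻¹ • transferHH k A G _ n (totalHH k A G n x)
  left_inv y := by
    classical
    change _ • transferHH k A G _ n (totalHH k A G n ((totalHH k A G n).symm _)) = y
    rw [LinearEquiv.apply_symm_apply, transferHH_resHH, smul_smul, inv_mul_cancel₀ hG, one_smul]
  right_inv x := by
    classical
    refine Subtype.ext ((totalHH k A G n).symm_apply_eq.2 ?_)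
    rw [map_smul, resHH_transferHH]
    simp_rw [← totalHH_conjTwistedHH, x.2 _]
    rw [Finset.sum_const, Finset.card_univ, ← Nat.cast_smul_eq_nsmul k, smul_smul,
      inv_mul_cancel₀ hG, one_smul]

theorem totalHH_equivInvariants (hG : (Fintype.card G : k) ≠ 0) {n : ℕ}
    (y : HH k (SkewMonoidAlgebra A G) (regular k (SkewMonoidAlgebra A G)) n) :
    totalHH k A G n (equivInvariants k A G hG n y : TwistedHH k A G n) = resHH k A G _ n y :=
  (totalHH k A G n).apply_symm_apply _

end Comparison

end CrossedHochschild

end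

theorem mainTheorem11 (k : Type u) [Field k] (A : Type v) [Ring A] [Algebra k A]
    (G : Type v) [Group G] [Fintype G] [MulSemiringAction G A] [SMulCommClass G k A]
    (hG : (Fintype.card G : k) ≠ 0) :
    ∃ e : ∀ n : ℕ,
        CrossedHochschild.HH k (SkewMonoidAlgebra A G)
          (CrossedHochschild.regular k (SkewMonoidAlgebra A G)) n ≃ₗ[k]
        CrossedHochschild.invariants k A G n,
      (e 0 (Abelian.Ext.mk₀ (𝟙 _)) : CrossedHochschild.TwistedHH k A G 0) =
          CrossedHochschild.oneTwistedHH ∧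
      ∀ (p q : ℕ)
        (x : CrossedHochschild.HH k (SkewMonoidAlgebra A G)
          (CrossedHochschild.regular k (SkewMonoidAlgebra A G)) p)
        (y : CrossedHochschild.HH k (SkewMonoidAlgebra A G)
          (CrossedHochschild.regular k (SkewMonoidAlgebra A G)) q),
        (e (p + q) (x.comp y rfl) : CrossedHochschild.TwistedHH k A G (p + q)) =
          CrossedHochschild.mulTwistedHH
            (e p x : CrossedHochschild.TwistedHH k A G p)
            (e q y : CrossedHochschild.TwistedHH k A G q) :=
  ⟨CrossedHochschild.equivInvariants k A G hG,
    (CrossedHochschild.totalHH k A G 0).injective <| by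
      rw [CrossedHochschild.totalHH_equivInvariants, CrossedHochschild.totalHH_oneTwistedHH],
    fun p q x y => (CrossedHochschild.totalHH k A G (p + q)).injective <| by
      rw [CrossedHochschild.totalHH_equivInvariants, CrossedHochschild.resHH_comp,
        CrossedHochschild.totalHH_mulTwistedHH _ _ y
          (CrossedHochschild.totalHH_equivInvariants hG y),
        CrossedHochschild.totalHH_equivInvariants]⟩
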